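/- All graphs are finite, non-null, undirected and simple. A Grundy coloring of a graph $G$ with $k$ colors is a partition of $V(G)$ into $k$ nonempty independent classes $C_1,\dots,C_k$ such that for all $i<j$ every vertex of $C_j$ has a neighbor in $C_i$; $\Gamma(G)$ is the maximum $k$ for which one exists. A color-dominating coloring of $G$ with $k$ colors is a partition of $V(G)$ into $k$ nonempty independent classes $C_1,\dots,C_k$ such that every $C_i$ contains a vertex which has a neighbor in every other class $C_j$, $j\neq i$; $\mathrm{b}(G)$ is the maximum $k$ for which one exists. A graph $G$ is $b$-monotone if $\mathrm{b}(H)\le \mathrm{b}(G)$ for every induced subgraph $H$ of $G$. A block of $G$ is a maximal subgraph among the connected subgraphs with at least two vertices and without a cut vertex, and $G$ is a cactus graph if every block of $G$ is isomorphic to an edge or to a cycle. Theorem. Let $G$ be a $b$-monotone cactus graph and let $k=\Gamma(G)$. Then $$\mathrm{b}(G)\ \ge\ k-2\lfloor \log_2 k\rfloor .$$ -/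

import Mathlib

namespace GrundyB

variable {V : Type*}

/-- A proper coloring of `G` with colors `0, …, k - 1`, all of them used, such that for all
colors `i < j` every vertex of color `j` has a neighbor of color `i`. -/
def IsGrundyColoring (G : SimpleGraph V) {k : ℕ} (C : G.Coloring (Fin k)) : Prop :=
  Function.Surjective C ∧ ∀ v : V, ∀ i : Fin k, i < C v → ∃ u : V, G.Adj v u ∧ C u = i

/-- A proper coloring of `G` with `k` colors such that every color class contains a vertex
having a neighbor in every other color class. (All classes are then nonempty.) -/
def IsColorDominatingColoring (G : SimpleGraph V) {k : ℕ} (C : G.Coloring (Fin k)) : Prop :=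
  ∀ i : Fin k, ∃ v : V, C v = i ∧ ∀ j : Fin k, j ≠ i → ∃ u : V, G.Adj v u ∧ C u = j

/-- `Γ(G)`: the maximum number of colors in a Grundy coloring. -/
noncomputable def grundyNumber (G : SimpleGraph V) : ℕ :=
  sSup {k : ℕ | ∃ C : G.Coloring (Fin k), IsGrundyColoring G C}

/-- `b(G)`: the maximum number of colors in a color-dominating coloring. -/
noncomputable def bChromaticNumber (G : SimpleGraph V) : ℕ :=
  sSup {k : ℕ | ∃ C : G.Coloring (Fin k), IsColorDominatingColoring G C}

/-- On a finite graph the supremum in `grundyNumber` is over a bounded set. -/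
theorem bddAbove_grundy [Fintype V] (G : SimpleGraph V) :
    BddAbove {k : ℕ | ∃ C : G.Coloring (Fin k), IsGrundyColoring G C} := by
  refine ⟨Fintype.card V, ?_⟩
  rintro k ⟨C, hC, -⟩
  simpa using Fintype.card_le_of_surjective C hC

/-- On a finite graph the supremum in `bChromaticNumber` is over a bounded set. -/
theorem bddAbove_colorDominating [Fintype V] (G : SimpleGraph V) :
    BddAbove {k : ℕ | ∃ C : G.Coloring (Fin k), IsColorDominatingColoring G C} := by
  refine ⟨Fintype.card V, ?_⟩
  rintro k ⟨C, hC⟩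
  have hs : Function.Surjective C := fun i => by
    obtain ⟨v, hv, -⟩ := hC i
    exact ⟨v, hv⟩
  simpa using Fintype.card_le_of_surjective C hs

/-- `b(H) ≤ b(G)` for every induced subgraph `H` of `G`. -/
def IsBMonotone (G : SimpleGraph V) : Prop :=
  ∀ s : Set V, bChromaticNumber (G.induce s) ≤ bChromaticNumber G

/-- A connected subgraph with at least two vertices and no cut vertex. As is usual when
speaking of blocks, a single edge with its two ends counts. -/
def IsTwoConnected {G : SimpleGraph V} (H : G.Subgraph) : Prop :=
  H.verts.Nontrivial ∧ H.Connected ∧ ∀ v ∈ H.verts, (H.deleteVerts {v}).Connected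

/-- A block: a subgraph that is maximal, for inclusion, among the 2-connected ones. -/
def IsBlock {G : SimpleGraph V} (H : G.Subgraph) : Prop :=
  Maximal IsTwoConnected H

/-- Every block is isomorphic to an edge or to a cycle. -/
def IsCactus (G : SimpleGraph V) : Prop :=
  ∀ H : G.Subgraph, IsBlock H →
    Nonempty (H.coe ≃g (⊤ : SimpleGraph (Fin 2))) ∨
      ∃ n : ℕ, 3 ≤ n ∧ Nonempty (H.coe ≃g SimpleGraph.cycleGraph n)

end GrundyB

namespace GrundyB

open scoped Classical
open Finset

/-! Write L for ⌊log₂ k⌋. In a Grundy coloring with colors 0, …, k - 1 take a vertex v of top color,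
and let n = k - 1 - 2L. By b-monotonicity it suffices to find an induced subgraph with a
color-dominating coloring with n + 1 colors. Such a subgraph is built from n + 1 centers of color at
least n, each with one neighbor of every color below n: if different centers have disjoint low
neighborhoods with no edges between them, the stars can be recolored independently.

The centers come from the component A of v among the colors at least n. Since A is connected and G
is a cactus, A can be 2-colored so that vertices whose low neighborhoods meet or are joined get
different values (`IsCactus.exists_separates`); one class of size n + 1 is enough, so |A| ≥ 2n + 1
is wanted.

A cactus on m vertices has at most 3(m - 1)/2 edges, whereas the Grundy property forces many
descending edges. Hence A grows by a factor 5/3 per level (`IsCactus.five_pow_le`), and after 2L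
levels (25/9)^L ≥ 2n + 1. -/

/-- `S` is nonempty and induces a connected subgraph, stated through cuts. -/
def IsLinked {V : Type*} (G : SimpleGraph V) (S : Finset V) : Prop :=
  S.Nonempty ∧ ∀ X ⊆ S, X.Nonempty → (∀ a ∈ X, ∀ b ∈ S, G.Adj a b → b ∈ X) → S ⊆ X

/-- `S` is the union of two proper subsets which share at most one vertex and have no edge
between their differences. -/
structure IsSplit {V : Type*} (G : SimpleGraph V) (S S₁ S₂ : Finset V) : Prop where
  union : S₁ ∪ S₂ = S
  left : S₁ ⊂ S
  right : S₂ ⊂ S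
  inter : ∀ a ∈ S₁, a ∈ S₂ → ∀ b ∈ S₁, b ∈ S₂ → a = b
  adj : ∀ a ∈ S₁, ∀ b ∈ S₂, G.Adj a b → a ∈ S₂ ∨ b ∈ S₁

variable {V : Type*} {G : SimpleGraph V} {S S₁ S₂ A B : Finset V}

theorem IsSplit.symm (h : IsSplit G S S₁ S₂) : IsSplit G S S₂ S₁ where
  union := by rw [union_comm]; exact h.union
  left := h.right
  right := h.left
  inter a h₂ h₁ b h₂' h₁' := h.inter a h₁ h₂ b h₁' h₂'
  adj a ha b hb hab := (h.adj b hb a ha hab.symm).symm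

/-! ### The structure of cactus graphs -/

theorem IsLinked.connected {H : G.Subgraph} (hS : IsLinked G S) (hv : H.verts = S)
    (hadj : ∀ a ∈ S, ∀ b ∈ S, G.Adj a b → H.Adj a b) : H.Connected := by
  have key : ∀ a : H.verts, ∀ b : H.verts, H.coe.Reachable a b := by
    intro a b
    have haS : (a : V) ∈ S := by simpa [hv] using a.2
    have hbS : (b : V) ∈ S := by simpa [hv] using b.2
    have := hS.2 (S.filter fun u => ∃ h : u ∈ H.verts, H.coe.Reachable a ⟨u, h⟩)
      (filter_subset _ _) ⟨a, by simp [haS]⟩ (by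
        intro x hx y hy hxy
        obtain ⟨hxS, hxv, hr⟩ := mem_filter.1 hx
        have hyv : y ∈ H.verts := by simpa [hv] using hy
        refine mem_filter.2 ⟨hy, hyv, hr.trans (SimpleGraph.Adj.reachable ?_)⟩
        simpa using hadj x hxS y hy hxy)
    obtain ⟨-, _, hr⟩ := mem_filter.1 (this hbS)
    exact hr
  obtain ⟨a, ha⟩ := hS.1
  exact SimpleGraph.Subgraph.connected_iff.2
    ⟨SimpleGraph.Subgraph.preconnected_iff.2 key, ⟨a, by simpa [hv] using ha⟩⟩

/-- A set that is not linked falls apart into two nonempty sets without edges between them. -/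
theorem exists_cut_of_not_isLinked (hne : S.Nonempty) (h : ¬ IsLinked G S) :
    ∃ X ⊂ S, X.Nonempty ∧ ∀ a ∈ X, ∀ b ∈ S, G.Adj a b → b ∈ X := by
  by_contra hcon
  refine h ⟨hne, fun X hX hXne hcl => ?_⟩
  by_contra hSX
  exact hcon ⟨X, ⟨hX, hSX⟩, hXne, hcl⟩

theorem card_neighbors_cycleGraph_le (n : ℕ) (hn : 3 ≤ n) (v : Fin n) :
    Set.ncard {w | (SimpleGraph.cycleGraph n).Adj v w} ≤ 2 := by
  obtain ⟨n, rfl⟩ := Nat.exists_eq_add_of_le' hn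
  refine le_trans (Set.ncard_le_ncard (t := {v - 1, v + 1}) (fun w hw => ?_)) ((Set.ncard_insert_le _ _).trans (by simp))
  rwa [← SimpleGraph.cycleGraph_neighborSet (n := n + 1)]

/-- By finiteness `H` lies in a block, and edges and cycles have maximum degree at most two. -/
theorem IsCactus.card_neighbors_le_of_isTwoConnected [Finite V] (hG : IsCactus G)
    {H : G.Subgraph} (hH : IsTwoConnected H) {T : Finset V} {a : V} (hT : ∀ b ∈ T, H.Adj a b) :
    T.card ≤ 2 := by
  obtain ⟨K, hHK, hK⟩ := Finite.exists_le_maximal (p := IsTwoConnected) hH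
  have hadj : ∀ b ∈ T, K.Adj a b := fun b hb => hHK.2 (hT b hb)
  rcases T.eq_empty_or_nonempty with rfl | ⟨b₀, hb₀⟩
  · simp
  have ha : a ∈ K.verts := K.edge_vert (hadj b₀ hb₀)
  have bound : ∀ {W : Type} [Finite W] (F : SimpleGraph W) (φ : K.coe ≃g F),
      (∀ v : W, Set.ncard {w | F.Adj v w} ≤ 2) → T.card ≤ 2 := by
    intro W _ F φ hF
    refine le_trans ?_ (hF (φ ⟨a, ha⟩))
    rw [← Set.ncard_coe_finset]
    refine Set.ncard_le_ncard_of_injOn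
      (fun b => if h : b ∈ K.verts then φ ⟨b, h⟩ else φ ⟨a, ha⟩) ?_ ?_
    · intro b hb
      have hbK : b ∈ K.verts := K.edge_vert (hadj b hb).symm
      have := φ.map_adj_iff.2 (show K.coe.Adj ⟨a, ha⟩ ⟨b, hbK⟩ from hadj b hb)
      simpa [hbK] using this
    · intro b hb c hc hbc
      have hbK : b ∈ K.verts := K.edge_vert (hadj b hb).symm
      have hcK : c ∈ K.verts := K.edge_vert (hadj c hc).symm
      simpa [hbK, hcK] using hbc
  rcases hG K hK with ⟨⟨φ⟩⟩ | ⟨n, hn, ⟨φ⟩⟩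
  · exact bound _ φ fun v => (Set.ncard_le_card _).trans (by simp)
  · exact bound _ φ (card_neighbors_cycleGraph_le n hn)

/-- A vertex set of a cactus either splits or induces a subgraph of maximum degree at most two. -/
theorem IsCactus.isSplit_or_card_neighbors_le [Finite V] (hG : IsCactus G) (S : Finset V) :
    (∃ S₁ S₂, IsSplit G S S₁ S₂) ∨ ∀ a ∈ S, (S.filter (G.Adj a)).card ≤ 2 := by
  rw [or_iff_not_imp_left]
  intro hns a ha
  rcases S.eq_singleton_or_nontrivial ha with hS | hnt
  · exact (card_le_card (filter_subset _ _)).trans (by simp [hS])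
  -- A disconnection or a cut vertex would give a split; without one, `S` induces a 2-connected
  -- subgraph.
  have hlink : IsLinked G S := by
    by_contra h
    obtain ⟨X, hX, ⟨x, hx⟩, hcl⟩ := exists_cut_of_not_isLinked ⟨a, ha⟩ h
    refine hns ⟨X, S \ X, union_sdiff_of_subset hX.1, hX, ?_, ?_, ?_⟩
    · exact ⟨sdiff_subset, fun h => (mem_sdiff.1 (h (hX.1 hx))).2 hx⟩
    · intro b hb hb'
      exact absurd hb (mem_sdiff.1 hb').2
    · intro b hb c hc hbc
      exact Or.inr (hcl b hb c (mem_sdiff.1 hc).1 hbc)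
  have hlink' : ∀ v ∈ S, IsLinked G (S.erase v) := by
    intro v hv
    by_contra h
    have hne : (S.erase v).Nonempty := by
      obtain ⟨w, hw, hwv⟩ := hnt.exists_ne v
      exact ⟨w, mem_erase.2 ⟨hwv, hw⟩⟩
    obtain ⟨X, hX, ⟨x, hx⟩, hcl⟩ := exists_cut_of_not_isLinked hne h
    obtain ⟨y, hy, hyX⟩ := exists_of_ssubset hX
    have hxS := mem_erase.1 (hX.1 hx)
    have hyS := mem_erase.1 hy
    have hXS : ∀ z ∈ X, z ∈ S := fun z hz => (mem_erase.1 (hX.1 hz)).2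
    refine hns ⟨insert v X, S \ X, ?_, ⟨?_, ?_⟩, ⟨sdiff_subset, ?_⟩, ?_, ?_⟩
    · ext z
      simp only [mem_union, mem_insert, mem_sdiff]
      constructor
      · rintro ((rfl | hz) | hz)
        exacts [hv, hXS z hz, hz.1]
      · tauto
    · exact insert_subset hv hXS
    · intro h
      rcases mem_insert.1 (h hyS.2) with h | h
      exacts [hyS.1 h, hyX h]
    · exact fun h => (mem_sdiff.1 (h hxS.2)).2 hx
    · intro b hb hb' c hc hc'
      rw [mem_insert, or_iff_left (mem_sdiff.1 hb').2] at hb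
      rw [mem_insert, or_iff_left (mem_sdiff.1 hc').2] at hc
      rw [hb, hc]
    · intro b hb c hc hbc
      rcases mem_insert.1 hb with rfl | hb
      · exact Or.inl (mem_sdiff.2 ⟨hv, fun h => (mem_erase.1 (hX.1 h)).1 rfl⟩)
      · by_cases hcv : c = v
        · exact Or.inr (by simp [hcv])
        · exact Or.inr (mem_insert_of_mem
            (hcl b hb c (mem_erase.2 ⟨hcv, (mem_sdiff.1 hc).1⟩) hbc))
  refine hG.card_neighbors_le_of_isTwoConnected
    (H := (⊤ : G.Subgraph).induce (S : Set V)) (a := a) ⟨?_, ?_, ?_⟩ ?_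
  · simpa using hnt
  · exact hlink.connected (by simp) (fun b hb c hc hbc => by simpa using ⟨hb, hc, hbc⟩)
  · intro v hv
    refine (hlink' v (by simpa using hv)).connected (by ext; simp [and_comm]) ?_
    intro b hb c hc hbc
    have hb' := mem_erase.1 hb
    have hc' := mem_erase.1 hc
    simp [hb', hc', hbc]
  · intro b hb
    have := mem_filter.1 hb
    simpa using ⟨ha, this⟩

/-! ### Counting edges -/

/-- The ordered pairs of adjacent vertices of `S`. -/
noncomputable def darts (G : SimpleGraph V) (S : Finset V) : Finset (V × V) :=
  (S ×ˢ S).filter fun p => G.Adj p.1 p.2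

theorem mem_darts {p : V × V} : p ∈ darts G S ↔ (p.1 ∈ S ∧ p.2 ∈ S) ∧ G.Adj p.1 p.2 := by
  simp [darts]

theorem card_darts (G : SimpleGraph V) (S : Finset V) :
    (darts G S).card = ∑ a ∈ S, (S.filter (G.Adj a)).card := by
  rw [darts, card_filter, sum_product]
  exact sum_congr rfl fun a _ => (card_filter _ _).symm

/-- At a split no edge is lost and |S₁| + |S₂| ≤ |S| + 1, so the bounds for the two sides add up.
Triangles attain equality. -/
theorem IsCactus.card_darts_add_three_le [Finite V] (hG : IsCactus G) (hS : S.Nonempty) :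
    (darts G S).card + 3 ≤ 3 * S.card := by
  induction S using Finset.strongInduction with
  | H S ih =>
    rcases hG.isSplit_or_card_neighbors_le S with ⟨S₁, S₂, h⟩ | hdeg
    · have h₁ : S₁.Nonempty := by
        obtain ⟨x, hx, hx'⟩ := exists_of_ssubset h.right
        rw [← h.union, mem_union] at hx
        exact ⟨x, hx.resolve_right hx'⟩
      have h₂ : S₂.Nonempty := by
        obtain ⟨x, hx, hx'⟩ := exists_of_ssubset h.left
        rw [← h.union, mem_union] at hx
        exact ⟨x, hx.resolve_left hx'⟩
      have hsub : darts G S ⊆ darts G S₁ ∪ darts G S₂ := by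
        rintro ⟨a, b⟩ hab
        simp only [mem_darts, mem_union, ← h.union] at hab ⊢
        have e₁ := fun ha hb => h.adj a ha b hb hab.2
        have e₂ := fun hb ha => h.adj b hb a ha hab.2.symm
        tauto
      have hc := (card_le_card hsub).trans (card_union_le _ _)
      have hi : (S₁ ∩ S₂).card ≤ 1 := card_le_one.2 fun a ha b hb =>
        h.inter a (mem_inter.1 ha).1 (mem_inter.1 ha).2 b (mem_inter.1 hb).1 (mem_inter.1 hb).2
      have hu := card_union_add_card_inter S₁ S₂
      rw [h.union] at hu
      have := ih S₁ h.left h₁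
      have := ih S₂ h.right h₂
      omega
    · have h2 : (darts G S).card ≤ S.card * 2 := by
        rw [card_darts]
        exact sum_le_card_nsmul _ _ _ hdeg
      -- The degree bound two is too weak when `S` has fewer than three vertices.
      have h3 : (darts G S).card ≤ S.card * (S.card - 1) := by
        rw [card_darts]
        refine sum_le_card_nsmul _ _ _ fun a ha => ?_
        rw [← card_erase_of_mem ha]
        refine card_le_card fun b hb => ?_
        obtain ⟨hb, hab⟩ := mem_filter.1 hb
        exact mem_erase.2 ⟨hab.ne', hb⟩
      have hpos := hS.card_pos
      by_cases hc : 3 ≤ S.card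
      · omega
      · generalize S.card = n at *
        interval_cases n <;> omega

/-- Grow a subset one vertex at a time along an edge leaving it; each step adds two darts. -/
theorem IsLinked.two_mul_card_le (hS : IsLinked G S) : 2 * S.card ≤ (darts G S).card + 2 := by
  have key : ∀ n, 1 ≤ n → n ≤ S.card → ∃ X ⊆ S, X.card = n ∧ 2 * n ≤ (darts G X).card + 2 := by
    intro n hn
    induction n, hn using Nat.le_induction with
    | base =>
      intro _
      obtain ⟨a, ha⟩ := hS.1
      exact ⟨{a}, by simpa using ha, by simp, by omega⟩
    | succ n hn ih =>
      intro hnS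
      obtain ⟨X, hXS, hXn, hX⟩ := ih (by omega)
      have hnot : ¬ ∀ a ∈ X, ∀ b ∈ S, G.Adj a b → b ∈ X := fun h => by
        have := card_le_card (hS.2 X hXS (card_pos.1 (by omega)) h)
        omega
      push Not at hnot
      obtain ⟨a, ha, b, hb, hab, hbX⟩ := hnot
      refine ⟨insert b X, insert_subset hb hXS, by rw [card_insert_of_notMem hbX, hXn], ?_⟩
      have hsub : insert (a, b) (insert (b, a) (darts G X)) ⊆ darts G (insert b X) := by
        intro p hp
        simp only [mem_insert, mem_darts] at hp ⊢
        rcases hp with rfl | rfl | hp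
        · simp [ha, hab]
        · simp [ha, hab.symm]
        · tauto
      have := card_le_card hsub
      rw [card_insert_of_notMem, card_insert_of_notMem] at this
      · omega
      · simp [mem_darts, hbX]
      · simp [mem_darts, hbX, hab.ne]
  obtain ⟨X, hXS, hXc, hX⟩ := key S.card hS.1.card_pos le_rfl
  rwa [eq_of_subset_of_card_le hXS hXc.ge] at hX

/-! ### Two-coloring a linked set -/

/-- `f` separates any two vertices of `A` which have neighbors in `B` that are equal or
adjacent. -/
def Separates (G : SimpleGraph V) (A B : Finset V) (f : V → Bool) : Prop :=
  ∀ a ∈ A, ∀ a' ∈ A, a ≠ a' → ∀ x ∈ B, ∀ y ∈ B, G.Adj a x → G.Adj a' y →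
    (x = y ∨ G.Adj x y) → f a ≠ f a'

theorem IsSplit.subset_or_subset (h : IsSplit G S S₁ S₂) (hA : IsLinked G A) (hAS : A ⊆ S)
    (hi : ∀ z ∈ A, z ∈ S₁ → z ∉ S₂) : A ⊆ S₁ ∨ A ⊆ S₂ := by
  have hAS' : ∀ z ∈ A, z ∈ S₁ ∨ z ∈ S₂ := fun z hz => by
    rw [← mem_union, h.union]; exact hAS hz
  rcases (A ∩ S₁).eq_empty_or_nonempty with he | hne
  · right
    intro z hz
    exact (hAS' z hz).resolve_left fun h1 => by simpa [he] using mem_inter.2 ⟨hz, h1⟩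
  · left
    refine (hA.2 (A ∩ S₁) inter_subset_left hne fun a ha b hb hab => ?_).trans inter_subset_right
    rw [mem_inter] at ha ⊢
    have := hAS' b hb
    have := hi a ha.1 ha.2
    have e := fun hb => h.adj a ha.2 b hb hab
    tauto

/-- The sides of `A` communicate only through `z`. So a closed part of `A ∩ S₁` contains `z`, and
together with `A ∩ S₂` it is closed in `A`. -/
theorem IsSplit.isLinked_inter (h : IsSplit G S S₁ S₂) (hA : IsLinked G A) (hAS : A ⊆ S) {z : V}
    (hzA : z ∈ A) (hz₁ : z ∈ S₁) (hz₂ : z ∈ S₂) : IsLinked G (A ∩ S₁) := by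
  have hAS' : ∀ z ∈ A, z ∈ S₁ ∨ z ∈ S₂ := fun z hz => by
    rw [← mem_union, h.union]; exact hAS hz
  have huniq : ∀ a ∈ S₁, a ∈ S₂ → a = z := fun a h1 h2 => h.inter a h1 h2 z hz₁ hz₂
  refine ⟨⟨z, by simp [hzA, hz₁]⟩, fun X hX hXne hcl => ?_⟩
  have hXA : ∀ x ∈ X, x ∈ A ∧ x ∈ S₁ := fun x hx => mem_inter.1 (hX hx)
  have hzX : z ∈ X := by
    by_contra hzX
    refine hzX (hA.2 X (fun x hx => (hXA x hx).1) hXne ?_ hzA)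
    intro a ha b hb hab
    by_cases hb1 : b ∈ S₁
    · exact hcl a ha b (mem_inter.2 ⟨hb, hb1⟩) hab
    · have hb2 := (hAS' b hb).resolve_left hb1
      have ha2 := (h.adj a (hXA a ha).2 b hb2 hab).resolve_right hb1
      exact absurd (huniq a (hXA a ha).2 ha2 ▸ ha) hzX
  have hfull : A ⊆ X ∪ A ∩ S₂ := by
    refine hA.2 _ (union_subset (fun x hx => (hXA x hx).1) inter_subset_left)
      ⟨z, mem_union_left _ hzX⟩ ?_
    intro a ha b hb hab
    by_cases hb2 : b ∈ S₂
    · exact mem_union_right _ (mem_inter.2 ⟨hb, hb2⟩)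
    have hb1 := (hAS' b hb).resolve_right hb2
    refine mem_union_left _ ?_
    rcases mem_union.1 ha with ha | ha
    · exact hcl a ha b (mem_inter.2 ⟨hb, hb1⟩) hab
    · have ha2 := (mem_inter.1 ha).2
      have ha1 := (h.adj b hb1 a ha2 hab.symm).resolve_left hb2
      have := huniq a ha1 ha2
      subst this
      exact hcl a hzX b (mem_inter.2 ⟨hb, hb1⟩) hab
  intro x hx
  obtain ⟨hxA, hx1⟩ := mem_inter.1 hx
  rcases mem_union.1 (hfull hxA) with h' | h'
  · exact h'
  · rw [huniq x hx1 (mem_inter.1 h').2]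
    exact hzX

theorem IsSplit.separates_of_subset (h : IsSplit G S S₁ S₂) (hB : B ⊆ S) (hA : A ⊆ S₁)
    (hi : ∀ z ∈ A, z ∈ S₁ → z ∉ S₂) {f : V → Bool} (hf : Separates G A (B ∩ S₁) f) :
    Separates G A B f := by
  have key : ∀ a ∈ A, ∀ x ∈ B, G.Adj a x → x ∈ B ∩ S₁ := by
    intro a ha x hx hax
    have hxS : x ∈ S₁ ∨ x ∈ S₂ := by rw [← mem_union, h.union]; exact hB hx
    have := hi a ha (hA ha)
    have e := fun hb => h.adj a (hA ha) x hb hax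
    rw [mem_inter]
    tauto
  intro a ha a' ha' hne x hx y hy hax hay
  exact hf a ha a' ha' hne x (key a ha x hx hax) y (key a' ha' y hy hay) hax hay

/-- In a split at a vertex `z` of `A`, a pair of vertices of `A` to be separated lies on the side
of the neighbors. -/
theorem IsSplit.separates_side (h : IsSplit G S S₁ S₂) (hA : A ⊆ S) (hB : B ⊆ S) {x y a a' : V}
    (hzB : ∀ b ∈ B, b ∈ S₁ → b ∉ S₂) (ha : a ∈ A) (ha' : a' ∈ A) (hx : x ∈ B) (hy : y ∈ B)
    (hax : G.Adj a x) (hay : G.Adj a' y) (hxy : x = y ∨ G.Adj x y) (hx₁ : x ∈ S₁) :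
    a ∈ S₁ ∧ a' ∈ S₁ ∧ y ∈ S₁ := by
  have mem : ∀ z ∈ S, z ∈ S₁ ∨ z ∈ S₂ := fun z hz => by rw [← mem_union, h.union]; exact hz
  have step : ∀ b ∈ B, b ∈ S₁ → ∀ c ∈ S, G.Adj b c → c ∈ S₁ := by
    intro b hb hb1 c hc hbc
    have := hzB b hb hb1
    have := mem c hc
    have e := fun hc => h.adj b hb1 c hc hbc
    tauto
  have hy1 : y ∈ S₁ := by
    rcases hxy with rfl | hxy
    exacts [hx₁, step x hx hx₁ y (hB hy) hxy]
  exact ⟨step x hx hx₁ a (hA ha) hax.symm, step y hy hy1 a' (hA ha') hay.symm, hy1⟩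

/-- A linked `A` already uses at least 2|A| - 2 of its at most 2|A| darts internally. Hence at most
two of its vertices have neighbors in `B`, and marking one of them separates them. -/
theorem exists_separates_of_card_neighbors_le (hAB : Disjoint A B) (hA : IsLinked G A)
    (hdeg : ∀ a ∈ A ∪ B, ((A ∪ B).filter (G.Adj a)).card ≤ 2) : ∃ f, Separates G A B f := by
  set T := A.filter fun a => ∃ x ∈ B, G.Adj a x with hT
  have hsum : (darts G A).card + T.card ≤ A.card * 2 := by
    rw [card_darts, hT, card_filter, ← sum_add_distrib]
    refine sum_le_card_nsmul _ _ _ fun a ha => ?_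
    refine le_trans ?_ (hdeg a (mem_union_left _ ha))
    split_ifs with hx
    · obtain ⟨x, hx, hax⟩ := hx
      have hxA : x ∉ A := fun h => disjoint_left.1 hAB h hx
      rw [← card_insert_of_notMem (a := x) (by simp [hxA])]
      refine card_le_card (insert_subset (by simp [hx, hax]) ?_)
      exact filter_subset_filter _ subset_union_left
    · exact card_le_card (filter_subset_filter _ subset_union_left)
  have hT2 : T.card ≤ 2 := by
    have := hA.two_mul_card_le
    omega
  have hmem : ∀ a ∈ A, ∀ x ∈ B, G.Adj a x → a ∈ T := fun a ha x hx hax =>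
    mem_filter.2 ⟨ha, x, hx, hax⟩
  rcases T.eq_empty_or_nonempty with he | ⟨t, ht⟩
  · refine ⟨fun _ => true, fun a ha a' ha' hne x hx y hy hax => ?_⟩
    simpa [he] using hmem a ha x hx hax
  · refine ⟨fun a => decide (a = t), fun a ha a' ha' hne x hx y hy hax hay _ hf => ?_⟩
    have h1 := hmem a ha x hx hax
    have h2 := hmem a' ha' y hy hay
    have hiff : a = t ↔ a' = t := by simpa using hf
    have hat : a ≠ t := fun h => hne (h.trans (hiff.1 h).symm)
    have hat' : a' ≠ t := fun h => hat (hiff.2 h)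
    have : ({a, a', t} : Finset V) ⊆ T := by
      intro u hu
      simp only [mem_insert, mem_singleton] at hu
      rcases hu with rfl | rfl | rfl <;> assumption
    have := card_le_card this
    rw [card_eq_three.2 ⟨a, a', t, hne, hat, hat', rfl⟩] at this
    omega

theorem IsCactus.exists_separates [Finite V] (hG : IsCactus G) (hAB : Disjoint A B)
    (hA : IsLinked G A) : ∃ f, Separates G A B f := by
  obtain ⟨S, hS⟩ : ∃ S, S = A ∪ B := ⟨_, rfl⟩
  induction S using Finset.strongInduction generalizing A B with
  | H S ih =>
    have hAS : A ⊆ S := hS ▸ subset_union_left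
    have hBS : B ⊆ S := hS ▸ subset_union_right
    rcases hG.isSplit_or_card_neighbors_le S with ⟨S₁, S₂, h⟩ | hdeg
    swap
    · exact exists_separates_of_card_neighbors_le hAB hA (hS ▸ hdeg)
    by_cases hz : ∃ z ∈ A, z ∈ S₁ ∧ z ∈ S₂
    · obtain ⟨z, hzA, hz₁, hz₂⟩ := hz
      have hu₁ : A ∩ S₁ ∪ B ∩ S₁ = S₁ := by
        rw [← union_inter_distrib_right, ← hS]; exact inter_eq_right.2 h.left.1
      have hu₂ : A ∩ S₂ ∪ B ∩ S₂ = S₂ := by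
        rw [← union_inter_distrib_right, ← hS]; exact inter_eq_right.2 h.right.1
      obtain ⟨f₁, hf₁⟩ := ih S₁ h.left (disjoint_of_subset_left inter_subset_left
        (disjoint_of_subset_right inter_subset_left hAB))
        (h.isLinked_inter hA hAS hzA hz₁ hz₂) hu₁.symm
      obtain ⟨f₂, hf₂⟩ := ih S₂ h.right (disjoint_of_subset_left inter_subset_left
        (disjoint_of_subset_right inter_subset_left hAB))
        (h.symm.isLinked_inter hA hAS hzA hz₂ hz₁) hu₂.symm
      have hB : ∀ b ∈ B, b ∈ S₁ → b ∉ S₂ := fun b hb h1 h2 =>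
        disjoint_left.1 hAB (h.inter b h1 h2 z hz₁ hz₂ ▸ hzA) hb
      have hB' : ∀ b ∈ B, b ∈ S₂ → b ∉ S₁ := fun b hb h2 h1 => hB b hb h1 h2
      -- Negating a separating function keeps it separating, so `f₂` is flipped if necessary to
      -- agree with `f₁` at `z`.
      set f : V → Bool := fun a => if a ∈ S₁ then f₁ a else xor (f₂ a) (xor (f₁ z) (f₂ z)) with hf
      have e₁ : ∀ a ∈ S₁, f a = f₁ a := fun a ha => by simp [hf, ha]
      have e₂ : ∀ a ∈ S₂, f a = xor (f₂ a) (xor (f₁ z) (f₂ z)) := fun a ha => by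
        by_cases ha1 : a ∈ S₁
        · rw [h.inter a ha1 ha z hz₁ hz₂, e₁ z hz₁]
          cases f₁ z <;> cases f₂ z <;> rfl
        · simp [hf, ha1]
      refine ⟨f, fun a ha a' ha' hne x hx y hy hax hay hxy => ?_⟩
      have hxS : x ∈ S₁ ∨ x ∈ S₂ := by rw [← mem_union, h.union]; exact hBS hx
      rcases hxS with hxS | hxS
      · obtain ⟨h1, h2, h3⟩ := h.separates_side hAS hBS hB ha ha' hx hy hax hay hxy hxS
        rw [e₁ a h1, e₁ a' h2]
        exact hf₁ a (mem_inter.2 ⟨ha, h1⟩) a' (mem_inter.2 ⟨ha', h2⟩) hne x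
          (mem_inter.2 ⟨hx, hxS⟩) y (mem_inter.2 ⟨hy, h3⟩) hax hay hxy
      · obtain ⟨h1, h2, h3⟩ := h.symm.separates_side hAS hBS hB' ha ha' hx hy hax hay hxy hxS
        rw [e₂ a h1, e₂ a' h2]
        have := hf₂ a (mem_inter.2 ⟨ha, h1⟩) a' (mem_inter.2 ⟨ha', h2⟩) hne x
          (mem_inter.2 ⟨hx, hxS⟩) y (mem_inter.2 ⟨hy, h3⟩) hax hay hxy
        simpa using this
    -- No vertex of `A` is shared, so `A` lies on one side and its neighbors in `B` lie there too.
    · have hi : ∀ z ∈ A, z ∈ S₁ → z ∉ S₂ := fun z hzA h1 h2 => hz ⟨z, hzA, h1, h2⟩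
      have hi' : ∀ z ∈ A, z ∈ S₂ → z ∉ S₁ := fun z hzA h2 h1 => hz ⟨z, hzA, h1, h2⟩
      have hu : ∀ U ⊆ S, A ⊆ U → U = A ∪ B ∩ U := fun U hU hAU => by
        exact (inter_eq_right.2 hU).symm.trans
          (by rw [hS, union_inter_distrib_right, inter_eq_left.2 hAU])
      rcases h.subset_or_subset hA hAS hi with hA' | hA'
      · obtain ⟨f, hf⟩ := ih S₁ h.left (disjoint_of_subset_right inter_subset_left hAB) hA
          (hu S₁ h.left.1 hA')
        exact ⟨f, h.separates_of_subset hBS hA' hi hf⟩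
      · obtain ⟨f, hf⟩ := ih S₂ h.right (disjoint_of_subset_right inter_subset_left hAB) hA
          (hu S₂ h.right.1 hA')
        exact ⟨f, h.symm.separates_of_subset hBS hA' hi' hf⟩

end GrundyB

namespace GrundyB

open scoped Classical
open Finset

/-! ### The components of the upper levels of a Grundy coloring -/

section upper

variable {V : Type*} [Fintype V] {G : SimpleGraph V} {c : V → ℕ} {v : V}

/-- The vertices joined to `v` by a path all of whose vertices, apart from `v`, have color at
least `l`. -/
noncomputable def upperComponent (G : SimpleGraph V) (c : V → ℕ) (v : V) (l : ℕ) : Finset V :=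
  univ.filter (Relation.ReflTransGen (fun a b => G.Adj a b ∧ l ≤ c b) v)

theorem mem_upperComponent {l : ℕ} {w : V} : w ∈ upperComponent G c v l ↔
    Relation.ReflTransGen (fun a b => G.Adj a b ∧ l ≤ c b) v w := by
  simp [upperComponent]

theorem self_mem_upperComponent (l : ℕ) : v ∈ upperComponent G c v l :=
  mem_upperComponent.2 .refl

theorem mem_upperComponent_of_adj {l : ℕ} {w u : V} (hw : w ∈ upperComponent G c v l)
    (hwu : G.Adj w u) (hu : l ≤ c u) : u ∈ upperComponent G c v l :=
  mem_upperComponent.2 ((mem_upperComponent.1 hw).tail ⟨hwu, hu⟩)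

theorem le_of_mem_upperComponent {l : ℕ} (hl : l ≤ c v) {w : V}
    (hw : w ∈ upperComponent G c v l) : l ≤ c w := by
  rcases (mem_upperComponent.1 hw).cases_tail with rfl | ⟨_, -, -, h⟩
  exacts [hl, h]

theorem upperComponent_anti {l l' : ℕ} (h : l ≤ l') :
    upperComponent G c v l' ⊆ upperComponent G c v l := fun _ hw =>
  mem_upperComponent.2
    (Relation.ReflTransGen.mono (fun _ _ hab => ⟨hab.1, h.trans hab.2⟩) _ _ (mem_upperComponent.1 hw))

theorem isLinked_upperComponent (l : ℕ) : IsLinked G (upperComponent G c v l) := by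
  refine ⟨⟨v, self_mem_upperComponent l⟩, fun X hX ⟨x, hx⟩ hcl => ?_⟩
  have hv : v ∈ X := by
    have hr := mem_upperComponent.1 (hX hx)
    induction hr with
    | refl => exact hx
    | tail hvb hbc ih =>
      have hb := mem_upperComponent.2 hvb
      exact ih (hcl _ hx _ hb hbc.1.symm)
  intro w hw
  have hr := mem_upperComponent.1 hw
  induction hr with
  | refl => exact hv
  | tail hvb hbc ih =>
    exact hcl _ (ih (mem_upperComponent.2 hvb)) _ hw hbc.1

/-- Each pair of a level `l` and a vertex of its component yields a dart descending to color `l - 1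
≥ j`. These darts are distinct, and their reversals do not descend. -/
theorem two_mul_sum_card_upperComponent_le
    (hgrundy : ∀ w, ∀ i < c w, ∃ u, G.Adj w u ∧ c u = i) (j : ℕ) :
    2 * ∑ l ∈ Ioc j (c v), (upperComponent G c v l).card
      ≤ (darts G (upperComponent G c v j)).card := by
  choose! g hg using hgrundy
  set O := (darts G (upperComponent G c v j)).filter fun p => c p.2 < c p.1 with hO
  set O' := (darts G (upperComponent G c v j)).filter fun p => ¬ c p.2 < c p.1 with hO'
  have hsum : ∑ l ∈ Ioc j (c v), (upperComponent G c v l).card ≤ O.card := by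
    rw [← card_sigma]
    refine card_le_card_of_injOn (fun q => (q.2, g q.2 (q.1 - 1))) ?_ ?_
    · rintro ⟨l, a⟩ h
      simp only [coe_sigma, Set.mem_sigma_iff, mem_coe, mem_Ioc] at h
      obtain ⟨⟨h1, h2⟩, ha⟩ := h
      have hla := le_of_mem_upperComponent h2 ha
      have hga := hg a (l - 1) (by omega)
      have haj := upperComponent_anti h1.le ha
      simp only [hO, coe_filter, Set.mem_ofPred_eq, mem_darts]
      exact ⟨⟨⟨haj, mem_upperComponent_of_adj haj hga.1 (by omega)⟩, hga.1⟩, by omega⟩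
    · rintro ⟨l, a⟩ h ⟨l', a'⟩ h' heq
      simp only [coe_sigma, Set.mem_sigma_iff, mem_coe, mem_Ioc] at h h'
      simp only [Prod.mk.injEq] at heq
      obtain ⟨rfl, heq⟩ := heq
      have hla := le_of_mem_upperComponent h.1.2 h.2
      have hla' := le_of_mem_upperComponent h'.1.2 h'.2
      have h1 := (hg a (l - 1) (by omega)).2
      have h2 := (hg a (l' - 1) (by omega)).2
      rw [heq] at h1
      obtain rfl : l = l' := by omega
      rfl
  have hswap : O.card ≤ O'.card := by
    refine card_le_card_of_injOn Prod.swap ?_ Prod.swap_injective.injOn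
    intro p hp
    simp only [hO, hO', coe_filter, Set.mem_ofPred_eq, mem_darts, Prod.fst_swap, Prod.snd_swap]
      at hp ⊢
    exact ⟨⟨hp.1.1.symm, hp.1.2.symm⟩, by omega⟩
  have : O.card + O'.card = (darts G (upperComponent G c v j)).card := by
    convert card_filter_add_card_filter_not (s := darts G (upperComponent G c v j))
      (fun p => c p.2 < c p.1)
  omega

/-- With u_l the component sizes, the two dart bounds give 3u_j ≥ 3 + 2∑_{l>j} u_l. Passing down one
level therefore multiplies the right-hand side by at least 5/3. -/
theorem IsCactus.five_pow_le (hG : IsCactus G)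
    (hgrundy : ∀ w, ∀ i < c w, ∃ u, G.Adj w u ∧ c u = i) {j t : ℕ} (hj : j + t = c v) :
    5 ^ t ≤ 3 ^ t * (upperComponent G c v j).card := by
  have key : ∀ j t, j + t = c v →
      3 * 5 ^ t ≤ 3 ^ t * (3 + 2 * ∑ l ∈ Ioc j (c v), (upperComponent G c v l).card) ∧
      3 * 5 ^ t ≤ 3 ^ t * (3 * (upperComponent G c v j).card) := by
    intro j t
    induction t generalizing j with
    | zero =>
      intro hj
      have : 0 < (upperComponent G c v j).card := card_pos.2 ⟨v, self_mem_upperComponent j⟩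
      constructor <;> simp only [pow_zero, one_mul, mul_one] <;> omega
    | succ t ih =>
      intro hj
      obtain ⟨h1, h2⟩ := ih (j + 1) (by omega)
      have hsplit : ∑ l ∈ Ioc j (c v), (upperComponent G c v l).card =
          (upperComponent G c v (j + 1)).card +
            ∑ l ∈ Ioc (j + 1) (c v), (upperComponent G c v l).card := by
        have hI : Ioc j (c v) = insert (j + 1) (Ioc (j + 1) (c v)) := by
          ext l
          simp only [mem_Ioc, mem_insert]
          omega
        rw [hI, sum_insert (by simp)]
      have h3 := two_mul_sum_card_upperComponent_le (G := G) (v := v) hgrundy j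
      have h4 := hG.card_darts_add_three_le (S := upperComponent G c v j)
        ⟨v, self_mem_upperComponent j⟩
      have h5 : 3 * 5 ^ (t + 1) ≤
          3 ^ (t + 1) * (3 + 2 * ∑ l ∈ Ioc j (c v), (upperComponent G c v l).card) := by
        rw [hsplit, pow_succ, pow_succ]
        nlinarith
      exact ⟨h5, h5.trans (Nat.mul_le_mul_left _ (by omega))⟩
  have := (key j t hj).2
  nlinarith

end upper

/-! ### Color-dominating colorings of sparse induced subgraphs -/

/-- The centers get distinct colors, and the leaves at each center take the remaining ones. By
`hsep`, edges join different stars only between centers. -/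
theorem exists_isColorDominatingColoring_induce {V : Type*} {G : SimpleGraph V} {c : V → ℕ} {n : ℕ}
    {D : Finset V} (hD : D.card = n + 1) (hDc : ∀ d ∈ D, n ≤ c d)
    (hnb : ∀ d ∈ D, ∀ i < n, ∃ u, G.Adj d u ∧ c u = i)
    (hsep : ∀ d ∈ D, ∀ d' ∈ D, d ≠ d' → ∀ x y, c x < n → c y < n → G.Adj d x → G.Adj d' y →
      x ≠ y ∧ ¬ G.Adj x y) :
    ∃ s : Set V, ∃ C : (G.induce s).Coloring (Fin (n + 1)), IsColorDominatingColoring _ C := by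
  have e : D ≃ Fin (n + 1) := Fintype.equivFinOfCardEq (by simpa using hD)
  have hnb' : ∀ (d : D) (i : Fin n), ∃ u, G.Adj d u ∧ c u = i := fun d i => hnb d d.2 i i.2
  choose x hx using hnb'
  have hlow : ∀ d i, c (x d i) < n := fun d i => (hx d i).2 ▸ i.2
  have hxD : ∀ d i, x d i ∉ D := fun d i h => absurd (hDc _ h) (hlow d i).not_ge
  have hinj : ∀ d i d' i', x d i = x d' i' → d = d' ∧ i = i' := by
    intro d i d' i' h
    constructor
    · by_contra hne
      exact (hsep d d.2 d' d'.2 (fun h => hne (Subtype.ext h)) _ _ (hlow d i) (hlow d' i')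
        (hx d i).1 (hx d' i').1).1 h
    · exact Fin.ext (by rw [← (hx d i).2, h, (hx d' i').2])
  let col : V → Fin (n + 1) := fun w =>
    if h : w ∈ D then e ⟨w, h⟩
    -- By `hinj` the chosen pair is the only one; the default 0 never occurs on `s`.
    else if h : ∃ q : D × Fin n, x q.1 q.2 = w then (e h.choose.1).succAbove h.choose.2 else 0
  have hcolD : ∀ d : D, col d = e d := fun d => by simp [col]
  have hcolx : ∀ d i, col (x d i) = (e d).succAbove i := by
    intro d i
    have h : ∃ q : D × Fin n, x q.1 q.2 = x d i := ⟨(d, i), rfl⟩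
    simp only [col, hxD, dif_pos h, dite_false]
    obtain ⟨h1, h2⟩ := hinj _ _ _ _ h.choose_spec
    rw [h1, h2]
  let s : Set V := {w | w ∈ D ∨ ∃ d i, x d i = w}
  have hmix : ∀ (d d' : D) i, G.Adj d (x d' i) → e d ≠ (e d').succAbove i := by
    intro d d' i hadj
    have : d = d' := by
      by_contra hne
      exact (hsep d d.2 d' d'.2 (fun h => hne (Subtype.ext h)) _ _ (hlow d' i) (hlow d' i)
        hadj (hx d' i).1).1 rfl
    subst this
    exact (Fin.succAbove_ne _ _).symm
  have hvalid : ∀ a ∈ s, ∀ b ∈ s, G.Adj a b → col a ≠ col b := by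
    rintro a (ha | ⟨d, i, rfl⟩) b (hb | ⟨d', i', rfl⟩) hab
    · rw [hcolD ⟨a, ha⟩, hcolD ⟨b, hb⟩]
      exact fun h => hab.ne (congrArg Subtype.val (e.injective h))
    · rw [hcolD ⟨a, ha⟩, hcolx]
      exact hmix ⟨a, ha⟩ d' i' hab
    · rw [hcolD ⟨b, hb⟩, hcolx]
      exact (hmix ⟨b, hb⟩ d i hab.symm).symm
    · have : d = d' := by
        by_contra hne
        exact (hsep d d.2 d' d'.2 (fun h => hne (Subtype.ext h)) _ _ (hlow d i) (hlow d' i')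
          (hx d i).1 (hx d' i').1).2 hab
      subst this
      rw [hcolx, hcolx]
      intro h
      exact hab.ne (by rw [Fin.succAbove_right_injective h])
  refine ⟨s, SimpleGraph.Coloring.mk (fun w => col w) (fun {a b} hab =>
    hvalid a a.2 b b.2 hab), fun i => ?_⟩
  refine ⟨⟨e.symm i, Or.inl (e.symm i).2⟩, ?_, fun j hj => ?_⟩
  · change col (e.symm i) = i
    rw [hcolD, e.apply_symm_apply]
  · obtain ⟨l, hl⟩ := Fin.exists_succAbove_eq hj
    refine ⟨⟨x (e.symm i) l, Or.inr ⟨_, _, rfl⟩⟩, (hx _ _).1, ?_⟩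
    change col (x (e.symm i) l) = j
    rw [hcolx, e.apply_symm_apply, hl]

theorem IsCactus.exists_isColorDominatingColoring_induce {V : Type*} [Fintype V]
    {G : SimpleGraph V} (hG : IsCactus G) {c : V → ℕ} {v : V} {n : ℕ}
    (hgrundy : ∀ w, ∀ i < c w, ∃ u, G.Adj w u ∧ c u = i) (hn : n ≤ c v)
    (hcard : 2 * n + 1 ≤ (upperComponent G c v n).card) :
    ∃ s : Set V, ∃ C : (G.induce s).Coloring (Fin (n + 1)), IsColorDominatingColoring _ C := by
  have hle : ∀ w ∈ upperComponent G c v n, n ≤ c w := fun w => le_of_mem_upperComponent hn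
  obtain ⟨f, hf⟩ := hG.exists_separates (A := upperComponent G c v n)
    (B := univ.filter fun w => c w < n) (disjoint_left.2 fun a ha hb =>
      absurd (hle a ha) (not_le.2 (mem_filter.1 hb).2)) (isLinked_upperComponent n)
  -- Pigeonhole: one of the two classes has at least n + 1 vertices.
  obtain ⟨b, hb⟩ : ∃ b, n + 1 ≤ ((upperComponent G c v n).filter fun w => f w = b).card := by
    by_contra! h
    have h1 := h true
    have h2 := h false
    have := card_filter_add_card_filter_not (s := upperComponent G c v n) (fun w => f w = true)
    simp only [Bool.not_eq_true] at this
    omega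
  obtain ⟨D, hDsub, hD⟩ := exists_subset_card_eq hb
  have hDA : ∀ d ∈ D, d ∈ upperComponent G c v n := fun d hd => (mem_filter.1 (hDsub hd)).1
  have hDf : ∀ d ∈ D, f d = b := fun d hd => (mem_filter.1 (hDsub hd)).2
  refine GrundyB.exists_isColorDominatingColoring_induce hD (fun d hd => hle d (hDA d hd))
    (fun d hd i hi => hgrundy d i (hi.trans_le (hle d (hDA d hd)))) ?_
  intro d hd d' hd' hne x y hx hy hdx hdy
  rw [← not_or]
  intro hxy
  exact hf d (hDA d hd) d' (hDA d' hd') hne x (by simpa using hx) y (by simpa using hy) hdx hdy hxy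
    ((hDf d hd).trans (hDf d' hd').symm)

/-- This is 2^(L+2) - 4L - 3 ≤ (25/9)^L cleared of denominators. The induction step needs 64L + 12 ≤
28·2^L, which fails at L = 2, so the induction starts at 3. -/
theorem nine_pow_mul_two_pow_le (L : ℕ) : 9 ^ L * 2 ^ (L + 2) ≤ 25 ^ L + 9 ^ L * (4 * L + 3) := by
  rcases lt_or_ge L 3 with h | h
  · interval_cases L <;> norm_num
  have aux : ∀ L ≥ 3, 64 * L + 12 ≤ 28 * 2 ^ L := by
    intro L hL
    induction L, hL using Nat.le_induction with
    | base => norm_num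
    | succ L hL ih => rw [pow_succ]; omega
  induction L, h using Nat.le_induction with
  | base => norm_num
  | succ L hL ih =>
    have h1 := Nat.mul_le_mul_left (9 ^ L) (aux L hL)
    simp only [pow_succ] at ih h1 ⊢
    nlinarith

end GrundyB

/-! ### The lower bound for b-monotone cacti -/

theorem theorem3p2 {V : Type*} [Fintype V] [Nonempty V] (G : SimpleGraph V)
    (hcactus : GrundyB.IsCactus G) (hmono : GrundyB.IsBMonotone G)
    (k : ℕ) (hk : GrundyB.grundyNumber G = k) :
    (k : ℤ) - 2 * ⌊Real.logb 2 (k : ℝ)⌋ ≤ (GrundyB.bChromaticNumber G : ℤ) := by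
  have hlog : ⌊Real.logb 2 (k : ℝ)⌋ = (Nat.log 2 k : ℤ) := by
    rw [← Int.log_natCast (R := ℝ), ← Real.floor_logb_natCast (by positivity)]
    norm_num
  rw [hlog]
  set L := Nat.log 2 k with hL
  -- If k ≤ 2L the bound is not positive; otherwise k > 0 and n = k - 1 - 2L is a genuine natural
  -- number.
  rcases le_or_gt k (2 * L) with hkL | hkL
  · have : (k : ℤ) ≤ 2 * (L : ℤ) := by exact_mod_cast hkL
    omega
  have hne : {k : ℕ | ∃ C : G.Coloring (Fin k), GrundyB.IsGrundyColoring G C}.Nonempty := by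
    by_contra h
    rw [Set.not_nonempty_iff_eq_empty] at h
    rw [GrundyB.grundyNumber, h] at hk
    simp at hk
    omega
  have hmem := Nat.sSup_mem hne (GrundyB.bddAbove_grundy G)
  rw [← GrundyB.grundyNumber, hk] at hmem
  obtain ⟨C, hsurj, hC⟩ := hmem
  obtain ⟨n, hn⟩ : ∃ n, k = n + 1 + 2 * L := ⟨k - 2 * L - 1, by omega⟩
  obtain ⟨v, hv⟩ := hsurj ⟨k - 1, by omega⟩
  have hgrundy : ∀ w, ∀ i < (C w : ℕ), ∃ u, G.Adj w u ∧ (C u : ℕ) = i := by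
    intro w i hi
    obtain ⟨u, hu, hui⟩ := hC w ⟨i, hi.trans (C w).2⟩ hi
    exact ⟨u, hu, by rw [hui]⟩
  have hcv : (C v : ℕ) = n + 2 * L := by rw [hv]; simp; omega
  have hgrow := hcactus.five_pow_le hgrundy (v := v) (j := n) (t := 2 * L) hcv.symm
  have hcard : 2 * n + 1 ≤ (GrundyB.upperComponent G (fun w => (C w : ℕ)) v n).card := by
    have hnum := GrundyB.nine_pow_mul_two_pow_le L
    have hlt : k < 2 ^ (L + 1) := Nat.lt_pow_succ_log_self (by norm_num) k
    rw [pow_mul, pow_mul] at hgrow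
    norm_num at hgrow
    -- The left side equals 2k + 2, and k + 1 ≤ 2^(L+1).
    have h1 : 2 * n + 1 + (4 * L + 3) ≤ 2 ^ (L + 2) := by
      rw [pow_succ]
      omega
    have h2 := Nat.mul_le_mul_left (9 ^ L) h1
    rw [mul_add] at h2
    exact Nat.le_of_mul_le_mul_left (by omega) (by positivity : 0 < 9 ^ L)
  obtain ⟨s, K, hK⟩ := hcactus.exists_isColorDominatingColoring_induce hgrundy
    (v := v) (n := n) (by omega) hcard
  have : Fintype s := Fintype.ofFinite s
  have hb : n + 1 ≤ GrundyB.bChromaticNumber G :=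
    (le_csSup (GrundyB.bddAbove_colorDominating (G.induce s)) ⟨K, hK⟩).trans (hmono s)
  omega
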